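/- **Theorem.** Let $\langle\kappa_i\mid i<\alpha\rangle$ be the increasing enumeration of a discrete set of measurable cardinals (i.e. $\sup_{j<i}\kappa_j<\kappa_i$ for all $i<\alpha$), let $U_i$ be a normal ultrafilter on $\kappa_i$, and let $\eta_i$ be an ordinal in $[1,\omega]$, for $i<\alpha$. Then the generalized Prikry forcing $\mathbb P=\mathbb P_{\vec\eta,\vec U}$, with the direct extension ordering $\le_1$, has the strong Prikry property. Here $\mathbb P$ consists of the pairs $\langle s,T\rangle$ such that * $s$ is a function whose domain is a finite subset of $\alpha$, and for $i\in\mathrm{dom}(s)$, $s(i)\subseteq\kappa_i\setminus\sup_{j<i}\kappa_j$ is finite of size in $[1,\eta_i]$ (put $s(i)=\emptyset$ for $i\notin\mathrm{dom}(s)$); * $T$ is a function with domain $\{i<\alpha : |s(i)|<\eta_i\}$, and for $i\in\mathrm{dom}(T)$, $T(i)\in U_i$, $T(i)\subseteq\kappa_i\setminus\sup_{j<i}\kappa_j$, and every element of $s(i)$ is smaller than every element of $T(i)$ (put $T(i)=\emptyset$ for $i\notin\mathrm{dom}(T)$). $\langle s',T'\rangle\le\langle s,T\rangle$ means that $s(i)\subseteq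 s'(i)$, $s'(i)\setminus s(i)\subseteq T(i)$ and $T'(i)\subseteq T(i)$ for all $i<\alpha$; and $\langle s',T'\rangle\le_1\langle s,T\rangle$ means that in addition $s'=s$. The largest condition is denoted by $\mathbb 1$. That $\langle\mathbb P,\le,\le_1\rangle$ has the strong Prikry property means: $\mathbb P$ is separative, $\le_1$ is a reflexive subrelation of $\le$, and, viewing $\mathbb P$ as a suborder of its Boolean completion $\mathbb B$, 1. (Prikry property) for every statement $\varphi$ of the forcing language of $\mathbb P$ and every $p\in\mathbb P$ there is $q\le_1p$ with $q\Vdash\varphi$ or $q\Vdash\neg\varphi$; 2. (directed) if $q,r\le_1p$, then there is $s\le_1p$ with $s\le q$ and $s\le r$; 3. (connected) if $q\le_1p$ and $q\le q'\le p$, then $q'\le_1p$; 4. (maximal antichains are captured) for every maximal antichain $A\subseteq\mathbb P$ and every $f:A\to\mathbb B$ with $f(a)\le a$ for all $a\in A$, $$\bigvee\{f(a)\mid a\in A\}\le_1\mathbb 1\iff\bigvee\{a\in A\mid f(a)\le_1a\}\le_1\mathbb 1,$$ where for $b\in\mathbb B$ and $p\in\mathbb P$, $b\le_1p$ means that $b\le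 p$ and there is $q\in\mathbb P$ with $q\le_1p$ and $q\le b$. -/

import Mathlib

universe u v

namespace StrongPrikry

/-! ## Notions of forcing

A notion of forcing is a partial order with a greatest element `⊤`; smaller conditions are
stronger. -/

section Forcing

variable {P : Type v} [PartialOrder P]

/-- Two conditions are compatible if they have a common extension. -/
def Compat (p q : P) : Prop := ∃ r : P, r ≤ p ∧ r ≤ q

/-- A poset is separative if whenever `p ≰ q`, some extension of `p` is incompatible with `q`. -/
def Separative (P : Type v) [PartialOrder P] : Prop :=
  ∀ p q : P, ¬ p ≤ q → ∃ r : P, r ≤ p ∧ ¬ Compat r q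

/-- An antichain (in the sense of forcing): distinct elements are incompatible. -/
def IsForcingAntichain (A : Set P) : Prop :=
  ∀ a ∈ A, ∀ b ∈ A, a ≠ b → ¬ Compat a b

/-- An antichain which is maximal with respect to inclusion. -/
def IsMaximalAntichain (A : Set P) : Prop := Maximal IsForcingAntichain A

/-! ### The Boolean completion -/

/-- The complete Boolean algebra of the poset `P`: the regular elements (those equal to their
double pseudo-complement) of the complete Heyting algebra of all downward closed subsets of `P`,
i.e. the regular open subsets of `P`. -/
def Completion (P : Type v) [PartialOrder P] : Type v := Heyting.Regular (LowerSet P)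

noncomputable instance : CompleteBooleanAlgebra (Completion P) :=
  { (inferInstance : BooleanAlgebra (Heyting.Regular (LowerSet P))),
    (Heyting.Regular.gi (α := LowerSet P)).liftCompleteLattice with }

/-- The canonical map from `P` to its Boolean completion, sending `p` to the regularization of
`{q | q ≤ p}`. -/
def emb (p : P) : Completion P := Heyting.Regular.toRegular (LowerSet.Iic p)

theorem mem_compl_iff (a : LowerSet P) (p : P) : p ∈ aᶜ ↔ ∀ r ≤ p, r ∉ a := by
  rw [← LowerSet.Iic_le, le_compl_iff_disjoint_right, disjoint_iff_inf_le]
  exact ⟨fun h r hr hra => h ⟨hr, hra⟩, fun h r hr => h r hr.1 hr.2⟩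

theorem mem_emb_iff (p q : P) : p ∈ (emb q).val ↔ ∀ r ≤ p, Compat r q := by
  change p ∈ (LowerSet.Iic q)ᶜᶜ ↔ _
  simp only [mem_compl_iff, LowerSet.mem_Iic_iff, Compat]
  push Not
  rfl

/-- A separative poset is a suborder of its Boolean completion. -/
theorem emb_le_emb_iff (h : Separative P) (p q : P) : emb p ≤ emb q ↔ p ≤ q := by
  refine ⟨fun hpq => ?_, fun hpq => Heyting.Regular.toRegular.monotone
    (LowerSet.Iic_le.2 hpq)⟩
  by_contra hn
  obtain ⟨r, hr, hrq⟩ := h p q hn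
  have hp : p ∈ (emb p).val := (mem_emb_iff p p).2 fun r hr => ⟨r, le_rfl, hr⟩
  have hq : p ∈ (emb q).val := hpq hp
  exact hrq ((mem_emb_iff p q).1 hq r hr)

/-- The image of `P` is dense in the Boolean completion of `P`. -/
theorem exists_emb_le (b : Completion P) (hb : b ≠ ⊥) : ∃ p : P, ⊥ < emb p ∧ emb p ≤ b := by
  have hne : ∃ p, p ∈ b.val := by
    by_contra! hn
    exact hb (Heyting.Regular.coe_injective (SetLike.ext fun p => iff_of_false (hn p) (fun h => h)))
  obtain ⟨p, hp⟩ := hne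
  refine ⟨p, bot_lt_iff_ne_bot.2 fun h => ?_, ?_⟩
  · have hp : p ∈ (emb p).val := (mem_emb_iff p p).2 fun r hr => ⟨r, le_rfl, hr⟩
    rw [h] at hp
    exact hp
  · exact (Heyting.Regular.gi.gc _ _).2 (LowerSet.Iic_le.2 hp)

/-! ### The forcing language -/

/-- `P`-names: a name is a (small) set of pairs consisting of a name and a condition. -/
inductive PName (P : Type v) : Type (v + 1)
  | mk (ι : Type v) (name : ι → PName P) (cond : ι → P) : PName P

/-- The Boolean value of `σ = τ`, for names `σ` and `τ`. -/
noncomputable def eqVal : PName P → PName P → Completion P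
  | .mk ι a c, .mk κ b d =>
      (⨅ i : ι, emb (c i) ⇨ ⨆ j : κ, emb (d j) ⊓ eqVal (a i) (b j)) ⊓
      (⨅ j : κ, emb (d j) ⇨ ⨆ i : ι, emb (c i) ⊓ eqVal (a i) (b j))

/-- The Boolean value of `σ ∈ τ`, for names `σ` and `τ`. -/
noncomputable def memVal (σ : PName P) : PName P → Completion P
  | .mk κ b d => ⨆ j : κ, emb (d j) ⊓ eqVal σ (b j)

/-- Formulas of the forcing language of `P` with `n` free variables: first order formulas in `=`
and `∈`, with the `P`-names as constants. The variables are de Bruijn levels. -/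
inductive ForcingFormula (P : Type v) : ℕ → Type (v + 1)
  | eq {n : ℕ} (x y : PName P ⊕ Fin n) : ForcingFormula P n
  | mem {n : ℕ} (x y : PName P ⊕ Fin n) : ForcingFormula P n
  | neg {n : ℕ} (φ : ForcingFormula P n) : ForcingFormula P n
  | and {n : ℕ} (φ ψ : ForcingFormula P n) : ForcingFormula P n
  | all {n : ℕ} (φ : ForcingFormula P (n + 1)) : ForcingFormula P n

/-- The Boolean value of a formula under an assignment of names to its free variables. -/
noncomputable def ForcingFormula.val : {n : ℕ} → ForcingFormula P n → (Fin n → PName P) →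
    Completion P
  | _, .eq x y, v => eqVal (Sum.elim id v x) (Sum.elim id v y)
  | _, .mem x y, v => memVal (Sum.elim id v x) (Sum.elim id v y)
  | _, .neg φ, v => (φ.val v)ᶜ
  | _, .and φ ψ, v => φ.val v ⊓ ψ.val v
  | _, .all φ, v => ⨅ σ : PName P, φ.val (Fin.snoc v σ)

/-- The forcing relation `p ⊩ φ`, for statements `φ` of the forcing language. -/
def Forces (p : P) (φ : ForcingFormula P 0) : Prop := emb p ≤ φ.val Fin.elim0

/-- `p` decides `φ`. -/
def Decides (p : P) (φ : ForcingFormula P 0) : Prop := Forces p φ ∨ Forces p φ.neg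

/-! ### The strong Prikry property -/

/-- The Prikry property of `⟨P, ≤, ≤₁⟩`, where `≤₁` is a reflexive subrelation of `≤`. -/
structure PrikryProperty (le₁ : P → P → Prop) : Prop where
  refl : ∀ p, le₁ p p
  le_of_le₁ : ∀ p q, le₁ p q → p ≤ q
  decides : ∀ (φ : ForcingFormula P 0) (p : P), ∃ q, le₁ q p ∧ Decides q φ

/-- The extension of `≤₁` to elements `b` of the Boolean completion: `b ≤₁ p` if `b ≤ p` and
`q ≤ b` for some condition `q ≤₁ p`. -/
def BoolLe₁ (le₁ : P → P → Prop) (b : Completion P) (p : P) : Prop :=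
  b ≤ emb p ∧ ∃ q : P, le₁ q p ∧ emb q ≤ b

/-- The strong Prikry property (as a poset) of `⟨P, ≤, ≤₁⟩`. -/
structure StrongPrikryProperty [OrderTop P] (le₁ : P → P → Prop) : Prop
    extends PrikryProperty le₁ where
  separative : Separative P
  directed : ∀ p q r : P, le₁ q p → le₁ r p → ∃ s, le₁ s p ∧ s ≤ q ∧ s ≤ r
  connected : ∀ p q q' : P, le₁ q p → q ≤ q' → q' ≤ p → le₁ q' p
  /-- Maximal antichains are captured. -/
  captured : ∀ A : Set P, IsMaximalAntichain A →
    ∀ f : A → Completion P, (∀ a : A, f a ≤ emb (a : P)) →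
      (BoolLe₁ le₁ (⨆ a : A, f a) ⊤ ↔
        BoolLe₁ le₁ (⨆ a : {a : A // BoolLe₁ le₁ (f a) (a : P)}, emb (a.1 : P)) ⊤)

end Forcing

/-! ## Generalized Prikry forcing -/

/-- `U` is a normal ultrafilter on the uncountable cardinal `κ` (so that `κ` is measurable). An
ultrafilter on `κ` is identified with an ultrafilter on the ordinals to which the set of the
ordinals below `κ` belongs. -/
structure IsNormalUltrafilter (κ : Cardinal.{u}) (U : Ultrafilter Ordinal.{u}) : Prop where
  uncountable : Cardinal.aleph0 < κ
  mem : Set.Iio κ.ord ∈ U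
  nonprincipal : ∀ ξ : Ordinal.{u}, {ξ} ∉ U
  /-- `U` is closed under intersections of fewer than `κ` of its members. -/
  complete : CardinalInterFilter (U : Filter Ordinal.{u}) (Cardinal.lift.{u + 1} κ)
  /-- `U` is closed under diagonal intersections. -/
  normal : ∀ X : Ordinal.{u} → Set Ordinal.{u}, (∀ ξ < κ.ord, X ξ ∈ U) →
    {β : Ordinal.{u} | ∀ ξ < β, β ∈ X ξ} ∈ U

/-- The parameters of a generalized Prikry forcing of length `α`: the monotone enumeration
`⟨κ i | i < α⟩` of a discrete set of measurable cardinals (that is, no `κ i` is the supremum of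
the `κ j` with `j < i`), normal ultrafilters `U i` on `κ i`, and `η i ∈ [1, ω]`. -/
structure PrikryParams (α : Ordinal.{u}) where
  κ : Set.Iio α → Cardinal.{u}
  strictMono : StrictMono κ
  discrete : ∀ i, ∃ δ < (κ i).ord, ∀ j < i, (κ j).ord ≤ δ
  U : Set.Iio α → Ultrafilter Ordinal.{u}
  normal : ∀ i, IsNormalUltrafilter (κ i) (U i)
  η : Set.Iio α → ℕ∞
  one_le_η : ∀ i, 1 ≤ η i

namespace PrikryParams

variable {α : Ordinal.{u}} (S : PrikryParams α)

/-- The set `κ i \ sup {κ j | j < i}` of ordinals. -/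
def block (i : Set.Iio α) : Set Ordinal.{u} :=
  {β | β < (S.κ i).ord ∧ ∀ j < i, (S.κ j).ord ≤ β}

/-- Conditions `⟨s, T⟩` of the generalized Prikry forcing. The partial functions `s` and `T` are
given by total functions with the value `∅` at indices outside of the domain; so the domain of `s`
is `{i | s i ≠ ∅}`, and the domain of `T` is `{i | |s i| < η i}`. -/
@[ext]
structure Condition where
  /-- The stem `s`. -/
  s : Set.Iio α → Finset Ordinal.{u}
  /-- The sequence `T` of measure one sets. -/
  T : Set.Iio α → Set Ordinal.{u}
  finite_dom : {i | s i ≠ ∅}.Finite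
  s_subset : ∀ i, (s i : Set Ordinal.{u}) ⊆ S.block i
  card_le : ∀ i, ((s i).card : ℕ∞) ≤ S.η i
  T_subset : ∀ i, T i ⊆ S.block i
  T_mem : ∀ i, ((s i).card : ℕ∞) < S.η i → T i ∈ S.U i
  T_eq_empty : ∀ i, ((s i).card : ℕ∞) = S.η i → T i = ∅
  s_lt_T : ∀ i, ∀ β ∈ s i, ∀ γ ∈ T i, β < γ

/-- `⟨s', T'⟩ ≤ ⟨s, T⟩` if `s i ⊆ s' i`, `s' i \ s i ⊆ T i` and `T' i ⊆ T i`, for all `i < α`. -/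
instance : PartialOrder S.Condition where
  le p q := ∀ i, q.s i ⊆ p.s i ∧ (∀ β ∈ p.s i, β ∉ q.s i → β ∈ q.T i) ∧ p.T i ⊆ q.T i
  le_refl p i := ⟨subset_rfl, fun _ h h' => absurd h h', subset_rfl⟩
  le_trans p q r hpq hqr i := by
    refine ⟨(hqr i).1.trans (hpq i).1, fun β hβ hβ' => ?_, (hpq i).2.2.trans (hqr i).2.2⟩
    by_cases h : β ∈ q.s i
    · exact (hqr i).2.1 β h hβ'
    · exact (hqr i).2.2 ((hpq i).2.1 β hβ h)
  le_antisymm p q hpq hqp := Condition.ext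
    (funext fun i => (hqp i).1.antisymm (hpq i).1)
    (funext fun i => (hpq i).2.2.antisymm (hqp i).2.2)

theorem block_mem (i : Set.Iio α) : S.block i ∈ S.U i := by
  obtain ⟨δ, hδ, hj⟩ := S.discrete i
  have hU := S.normal i
  have h : ⋂₀ ((fun ξ : Ordinal.{u} => ({ξ} : Set Ordinal.{u})ᶜ) '' Set.Iio δ) ∈
      (S.U i : Filter Ordinal.{u}) := by
    refine hU.complete.cardinal_sInter_mem _ ?_ ?_
    · refine Cardinal.mk_image_le.trans_lt ?_
      rw [Cardinal.mk_Iio_ordinal, Cardinal.lift_lt]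
      exact Cardinal.lt_ord.1 hδ
    · rintro _ ⟨ξ, -, rfl⟩
      exact Ultrafilter.compl_mem_iff_notMem.2 (hU.nonprincipal ξ)
  filter_upwards [hU.mem, h] with β hβ hβ'
  refine ⟨hβ, fun j hji => (hj j hji).trans (not_lt.1 fun hlt => ?_)⟩
  exact hβ' _ ⟨β, hlt, rfl⟩ rfl

/-- The weakest condition has the empty stem, and its measure one sets are as large as
possible. -/
instance : OrderTop S.Condition where
  top :=
    { s := fun _ => ∅
      T := S.block
      finite_dom := by simp
      s_subset := by simp
      card_le := by simp
      T_subset := fun _ => subset_rfl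
      T_mem := fun i _ => S.block_mem i
      T_eq_empty := fun i h => by
        have := S.one_le_η i
        simp [← h] at this
      s_lt_T := by simp }
  le_top p i := ⟨by simp, fun β hβ _ => p.s_subset i hβ, p.T_subset i⟩

/-- The direct extension ordering: a direct extension is an extension with the same stem. -/
def DirectExt (p q : S.Condition) : Prop := p ≤ q ∧ p.s = q.s

end PrikryParams

end StrongPrikry

/-! Conditions with the same stem are compatible: intersect their measure one sets. So whether some
condition with stem `s` forces a Boolean value `b` depends on `s` alone; this is `StemForces b s`.

Two facts carry the proof. By `stemForces_of_addPoint`, if for `U i`-many `ξ` the stem with `ξ`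
added at `i` forces `b`, the original stem already does: the witnesses amalgamate, by stabilization
below `i`, a diagonal intersection at `i` and completeness above `i`. By
`exists_forall_not_stemForces`, if the stem of `p` does not force `b`, a diagonal intersection gives
a direct extension of `p` below which no stem forces `b`; the new points are added one at a time in
increasing order.

The Prikry property is immediate from the second fact. For antichains, apply it at `⊤` to the
supremum of `f` or to its complement: some direct extension of `⊤` is incompatible with every `a`
whose stem forces that value. The Prikry property below each `a` then links `f a` to the supremum.
-/

namespace StrongPrikry

/-! ### Forcing Boolean values and density. -/

section Forcing

variable {P : Type v} [PartialOrder P]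

theorem emb_mono {p q : P} (h : p ≤ q) : emb p ≤ emb q :=
  Heyting.Regular.toRegular.monotone (LowerSet.Iic_le.2 h)

theorem mem_emb_self (p : P) : p ∈ (emb p).val :=
  (mem_emb_iff p p).2 fun r hr => ⟨r, le_rfl, hr⟩

theorem emb_ne_bot (p : P) : emb p ≠ ⊥ := fun h => by
  have hp := mem_emb_self p
  rw [h] at hp
  exact hp

theorem compat_of_emb_le {p q : P} (h : emb p ≤ emb q) : Compat p q :=
  (mem_emb_iff p q).1 (h (mem_emb_self p)) p le_rfl

theorem not_emb_le_compl {p : P} {b : Completion P} (h : emb p ≤ b) : ¬ emb p ≤ bᶜ := fun h' =>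
  emb_ne_bot p (le_bot_iff.1 ((le_inf h h').trans inf_compl_eq_bot.le))

/-- If no extension of `p` forces `b`, then `p` forces the complement of `b`. -/
theorem emb_le_compl {p : P} {b : Completion P} (h : ∀ r ≤ p, ¬ emb r ≤ b) : emb p ≤ bᶜ := by
  rw [le_compl_iff_disjoint_right, disjoint_iff]
  by_contra hne
  obtain ⟨r, -, hr⟩ := exists_emb_le _ hne
  obtain ⟨t, htr, htp⟩ := compat_of_emb_le (hr.trans inf_le_left)
  exact h t htp ((emb_mono htr).trans (hr.trans inf_le_right))

theorem emb_le_of_dense {p : P} {b : Completion P} (h : ∀ r ≤ p, ∃ t ≤ r, emb t ≤ b) :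
    emb p ≤ b := by
  rw [← compl_compl b]
  refine emb_le_compl fun r hr hrb => ?_
  obtain ⟨t, htr, htb⟩ := h r hr
  exact not_emb_le_compl htb ((emb_mono htr).trans hrb)

theorem exists_emb_le_of_le_iSup {ι : Sort*} {p : P} {g : ι → Completion P}
    (h : emb p ≤ ⨆ a, g a) : ∃ a, ∃ r ≤ p, emb r ≤ g a := by
  by_contra! hn
  refine not_emb_le_compl h ?_
  rw [compl_iSup]
  exact le_iInf fun a => emb_le_compl (hn a)

theorem IsMaximalAntichain.exists_compat {A : Set P} (hA : IsMaximalAntichain A) (p : P) :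
    ∃ a ∈ A, Compat p a := by
  by_contra! hn
  have h : IsForcingAntichain (insert p A) := by
    rintro a (rfl | ha) b (rfl | hb) hab
    · exact absurd rfl hab
    · exact hn b hb
    · exact fun ⟨r, h₁, h₂⟩ => hn a ha ⟨r, h₂, h₁⟩
    · exact hA.prop a ha b hb hab
  exact hn p (hA.le_of_ge h (Set.subset_insert p A) (Set.mem_insert p A)) ⟨p, le_rfl, le_rfl⟩

end Forcing

/-! ### Completeness and diagonal intersections for normal ultrafilters. -/

namespace IsNormalUltrafilter

variable {κ : Cardinal.{u}} {U : Ultrafilter Ordinal.{u}}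

theorem iInter_mem (h : IsNormalUltrafilter κ U) {ι : Type (u + 1)}
    (hι : Cardinal.mk ι < Cardinal.lift.{u + 1} κ) {X : ι → Set Ordinal.{u}}
    (hX : ∀ a, X a ∈ U) : ⋂ a, X a ∈ U := by
  rw [← Set.sInter_range]
  exact h.complete.cardinal_sInter_mem _ (Cardinal.mk_range_le.trans_lt hι)
    (Set.forall_mem_range.2 hX)

theorem mk_Iio_lt {δ : Ordinal.{u}} (hδ : δ < κ.ord) :
    Cardinal.mk (Set.Iio δ) < Cardinal.lift.{u + 1} κ := by
  rw [Cardinal.mk_Iio_ordinal, Cardinal.lift_lt]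
  exact Cardinal.lt_ord.1 hδ

theorem forall_lt_mem (h : IsNormalUltrafilter κ U) {δ : Ordinal.{u}} (hδ : δ < κ.ord)
    {X : Ordinal.{u} → Set Ordinal.{u}} (hX : ∀ β < δ, X β ∈ U) :
    {ξ | ∀ β < δ, ξ ∈ X β} ∈ U := by
  refine Filter.mem_of_superset
    (h.iInter_mem (X := fun β : Set.Iio δ => X β) (mk_Iio_lt hδ) fun β => hX β β.2) ?_
  exact fun ξ hξ β hβ => Set.mem_iInter.1 hξ ⟨β, hβ⟩

theorem succ_lt (h : IsNormalUltrafilter κ U) {ξ : Ordinal.{u}} (hξ : ξ < κ.ord) :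
    Order.succ ξ < κ.ord :=
  (Cardinal.isSuccLimit_ord h.uncountable.le).succ_lt hξ

theorem Ioi_mem (h : IsNormalUltrafilter κ U) {ξ : Ordinal.{u}} (hξ : ξ < κ.ord) :
    Set.Ioi ξ ∈ U := by
  filter_upwards [h.forall_lt_mem (h.succ_lt hξ) (X := fun β => {β}ᶜ) fun β _ =>
    Ultrafilter.compl_mem_iff_notMem.2 (h.nonprincipal β)] with γ hγ
  refine not_le.1 fun hle => hγ γ (Order.lt_succ_of_le hle) rfl

/-- Closure under diagonal intersections of families indexed by finite sets of ordinals. -/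
theorem diagonal_finset_mem (h : IsNormalUltrafilter κ U)
    {Y : Finset Ordinal.{u} → Set Ordinal.{u}} (hY : ∀ u, Y u ∈ U) :
    {γ | ∀ u : Finset Ordinal.{u}, (∀ β ∈ u, β < γ) → γ ∈ Y u} ∈ U := by
  -- A nonempty `u` is handled at the index `ξ = max u`; the successor lets `u` contain `ξ` itself.
  -- There are fewer than `κ` such `u`. The empty set has no maximum and is treated separately.
  have hX : ∀ ξ < κ.ord, (⋂ u : Finset (Set.Iio (Order.succ ξ)),
      Y (u.map (Function.Embedding.subtype _))) ∈ U := by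
    intro ξ hξ
    refine h.iInter_mem ?_ fun u => hY _
    have hlt := mk_Iio_lt (h.succ_lt hξ)
    cases finite_or_infinite (Set.Iio (Order.succ ξ))
    · refine (Cardinal.lt_aleph0_of_finite _).trans ?_
      rw [← Cardinal.lift_aleph0.{u + 1, u}, Cardinal.lift_lt]
      exact h.uncountable
    · rwa [Cardinal.mk_finset_of_infinite]
  filter_upwards [h.normal _ hX, hY ∅] with γ hγ hγ' u hu
  rcases u.eq_empty_or_nonempty with rfl | hne
  · exact hγ'
  · have := Set.mem_iInter.1 (hγ (u.max' hne) (hu _ (u.max'_mem hne)))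
      (u.subtype fun β => β ∈ Set.Iio (Order.succ (u.max' hne)))
    rwa [Finset.subtype_map_of_mem] at this
    exact fun β hβ => Order.lt_succ_of_le (u.le_max' β hβ)

end IsNormalUltrafilter

/-! ### Building and amalgamating conditions. -/

namespace PrikryParams

variable {α : Ordinal.{u}} (S : PrikryParams α)

theorem block_unique {i j : Set.Iio α} {β : Ordinal.{u}} (hi : β ∈ S.block i)
    (hj : β ∈ S.block j) : i = j := by
  rcases lt_trichotomy i j with h | h | h
  · exact absurd hi.1 (hj.2 i h).not_gt
  · exact h
  · exact absurd hj.1 (hi.2 j h).not_gt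

namespace Condition

variable {S}

theorem card_lt_of_mem_T (p : S.Condition) {i : Set.Iio α} {γ : Ordinal.{u}} (hγ : γ ∈ p.T i) :
    ((p.s i).card : ℕ∞) < S.η i := by
  refine (p.card_le i).lt_of_ne fun h => ?_
  rw [p.T_eq_empty i h] at hγ
  exact hγ

/-- Two conditions are compatible if the stem of the first one extends that of the second one
inside the measure one sets of the second one. -/
theorem exists_le_of_stem (p q : S.Condition) (h : ∀ i, q.s i ⊆ p.s i)
    (h' : ∀ i, ∀ β ∈ p.s i, β ∉ q.s i → β ∈ q.T i) : ∃ r, r.s = p.s ∧ r ≤ p ∧ r ≤ q := by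
  refine ⟨{
    s := p.s
    T := fun i => p.T i ∩ q.T i
    finite_dom := p.finite_dom
    s_subset := p.s_subset
    card_le := p.card_le
    T_subset := fun i => Set.inter_subset_left.trans (p.T_subset i)
    T_mem := fun i hi => Filter.inter_mem (p.T_mem i hi) (q.T_mem i (lt_of_le_of_lt ?_ hi))
    T_eq_empty := fun i hi => by rw [p.T_eq_empty i hi, Set.empty_inter]
    s_lt_T := fun i β hβ γ hγ => p.s_lt_T i β hβ γ hγ.1 }, rfl, fun i => ?_, fun i => ?_⟩
  · exact_mod_cast Finset.card_le_card (h i)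
  · exact ⟨subset_rfl, fun _ h h' => absurd h h', Set.inter_subset_left⟩
  · exact ⟨h i, h' i, Set.inter_subset_right⟩

theorem exists_le_of_stem_eq {p q : S.Condition} (h : p.s = q.s) :
    ∃ r, r.s = p.s ∧ r ≤ p ∧ r ≤ q :=
  exists_le_of_stem p q (fun i => by rw [h]) fun i β hβ hβ' => absurd (h ▸ hβ) hβ'

/-- Shrinking the measure one sets of a condition. -/
theorem exists_shrink (p : S.Condition) (R : Set.Iio α → Set Ordinal.{u})
    (hR : ∀ i, ((p.s i).card : ℕ∞) < S.η i → R i ∈ S.U i) :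
    ∃ q : S.Condition, q.s = p.s ∧ q ≤ p ∧ ∀ i, q.T i = p.T i ∩ R i :=
  ⟨{
    s := p.s
    T := fun i => p.T i ∩ R i
    finite_dom := p.finite_dom
    s_subset := p.s_subset
    card_le := p.card_le
    T_subset := fun i => Set.inter_subset_left.trans (p.T_subset i)
    T_mem := fun i hi => Filter.inter_mem (p.T_mem i hi) (hR i hi)
    T_eq_empty := fun i hi => by rw [p.T_eq_empty i hi, Set.empty_inter]
    s_lt_T := fun i β hβ γ hγ => p.s_lt_T i β hβ γ hγ.1 }, rfl,
    fun _ => ⟨subset_rfl, fun _ h h' => absurd h h', Set.inter_subset_left⟩, fun _ => rfl⟩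

theorem setOf_forall_lt_mem {i : Set.Iio α} {u : Finset Ordinal.{u}}
    (hu : (u : Set Ordinal.{u}) ⊆ S.block i) : {γ | ∀ β ∈ u, β < γ} ∈ S.U i := by
  have : (⋂ β ∈ u, Set.Ioi β) ∈ (S.U i : Filter Ordinal.{u}) :=
    (Filter.biInter_finset_mem u).2 fun β hβ => (S.normal i).Ioi_mem (hu hβ).1
  filter_upwards [this] with γ hγ β hβ
  exact Set.mem_iInter₂.1 hγ β hβ

/-- Every part of a stem is a stem. -/
theorem exists_stem_eq (p : S.Condition) (s : Set.Iio α → Finset Ordinal.{u})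
    (hs : ∀ i, s i ⊆ p.s i) : ∃ q : S.Condition, q.s = s := by
  classical
  have hb : ∀ i, (s i : Set Ordinal.{u}) ⊆ S.block i := fun i =>
    (Finset.coe_subset.2 (hs i)).trans (p.s_subset i)
  refine ⟨{
    s := s
    T := fun i => {γ | γ ∈ S.block i ∧ ((s i).card : ℕ∞) ≠ S.η i ∧ ∀ β ∈ s i, β < γ}
    finite_dom := p.finite_dom.subset fun i hi h => hi (Finset.subset_empty.1 (h ▸ hs i))
    s_subset := hb
    card_le := fun i => le_trans ?_ (p.card_le i)
    T_subset := fun i γ hγ => hγ.1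
    T_mem := fun i hi => ?_
    T_eq_empty := fun i hi => Set.eq_empty_of_forall_notMem fun γ hγ => hγ.2.1 hi
    s_lt_T := fun i β hβ γ hγ => hγ.2.2 β hβ }, rfl⟩
  · exact_mod_cast Finset.card_le_card (hs i)
  · filter_upwards [S.block_mem i, setOf_forall_lt_mem (hb i)] with γ h₁ h₂
    exact ⟨h₁, hi.ne, h₂⟩

open Classical in
/-- The stem `s` with `γ` added at the index `i`. -/
noncomputable def addPoint (s : Set.Iio α → Finset Ordinal.{u}) (i : Set.Iio α) (γ : Ordinal.{u}) :
    Set.Iio α → Finset Ordinal.{u} :=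
  fun j => if j = i then insert γ (s i) else s j

theorem mem_addPoint {s : Set.Iio α → Finset Ordinal.{u}} {i j : Set.Iio α} {β γ : Ordinal.{u}} :
    β ∈ addPoint s i γ j ↔ β ∈ s j ∨ j = i ∧ β = γ := by
  unfold addPoint
  split_ifs with h
  · subst h
    simp [or_comm]
  · simp [h]

/-- A point of a measure one set may be added to the stem. -/
theorem exists_add (p : S.Condition) {i : Set.Iio α} {γ : Ordinal.{u}} (hγ : γ ∈ p.T i) :
    ∃ q ≤ p, q.s = addPoint p.s i γ ∧ ∀ β ∈ q.T i, γ < β := by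
  classical
  have hsub : ∀ j, p.s j ⊆ addPoint p.s i γ j := fun j β hβ => mem_addPoint.2 (Or.inl hβ)
  have hb : ∀ j, (addPoint p.s i γ j : Set Ordinal.{u}) ⊆ S.block j := by
    intro j β hβ
    rcases mem_addPoint.1 hβ with h | ⟨rfl, rfl⟩
    · exact p.s_subset j h
    · exact p.T_subset j hγ
  have hcard : ∀ j, ((p.s j).card : ℕ∞) ≤ (addPoint p.s i γ j).card := fun j => by
    exact_mod_cast Finset.card_le_card (hsub j)
  refine ⟨{
    s := addPoint p.s i γ
    T := fun j => {β | β ∈ p.T j ∧ ((addPoint p.s i γ j).card : ℕ∞) ≠ S.η j ∧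
      ∀ δ ∈ addPoint p.s i γ j, δ < β}
    finite_dom := ?_
    s_subset := hb
    card_le := fun j => ?_
    T_subset := fun j β hβ => p.T_subset j hβ.1
    T_mem := fun j hj => ?_
    T_eq_empty := fun j hj => Set.eq_empty_of_forall_notMem fun β hβ => hβ.2.1 hj
    s_lt_T := fun j β hβ δ hδ => hδ.2.2 β hβ }, fun j => ⟨hsub j, ?_, fun β hβ => hβ.1⟩, rfl, ?_⟩
  · refine (p.finite_dom.insert i).subset fun j hj => ?_
    by_cases h : j = i
    · exact Or.inl h
    · refine Or.inr fun h0 => hj ?_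
      simpa [addPoint, h] using h0
  · unfold addPoint
    split_ifs with h
    · subst h
      refine le_trans ?_ (Order.add_one_le_of_lt (p.card_lt_of_mem_T hγ))
      exact_mod_cast Finset.card_insert_le _ _
    · exact p.card_le j
  · filter_upwards [p.T_mem j ((hcard j).trans_lt hj), setOf_forall_lt_mem (hb j)] with β h₁ h₂
    exact ⟨h₁, hj.ne, h₂⟩
  · intro β hβ hβ'
    rcases mem_addPoint.1 hβ with h | ⟨rfl, rfl⟩
    · exact absurd h hβ'
    · exact hγ
  · exact fun β hβ => hβ.2.2 γ (mem_addPoint.2 (Or.inr ⟨rfl, rfl⟩))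

end Condition

open Condition

/-! ### Separativity. -/

theorem separative_condition : Separative S.Condition := by
  intro p q hpq
  obtain ⟨i, hi⟩ := not_forall.1 hpq
  /- An extension of `p` skipping a point of the stem of `q` is incompatible with `q`. -/
  have key : ∀ β ∈ q.s i, β ∉ p.s i → ∃ r ≤ p, ¬ Compat r q := by
    intro β hβ hβp
    by_cases hT : β ∈ p.T i
    -- Adding a point `γ` above `β` excludes `β` for good, since all later points at `i` exceed `γ`.
    · obtain ⟨γ, hγ, hlt⟩ := Filter.nonempty_of_mem (Filter.inter_mem
        (p.T_mem i (p.card_lt_of_mem_T hT)) ((S.normal i).Ioi_mem (p.T_subset i hT).1))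
      obtain ⟨r, hr, hrs, hrT⟩ := p.exists_add hγ
      refine ⟨r, hr, fun ⟨t, htr, htq⟩ => ?_⟩
      have hβr : β ∉ r.s i := by
        rw [hrs, mem_addPoint]
        rintro (h | ⟨-, h⟩)
        · exact hβp h
        · exact hlt.ne h
      exact lt_asymm hlt (hrT β ((htr i).2.1 β ((htq i).1 hβ) hβr))
    · exact ⟨p, le_rfl, fun ⟨t, htp, htq⟩ => hT ((htp i).2.1 β ((htq i).1 hβ) hβp)⟩
  by_cases h₁ : q.s i ⊆ p.s i
  · by_cases h₂ : ∀ β ∈ p.s i, β ∉ q.s i → β ∈ q.T i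
    · obtain ⟨γ, hγ, hγq⟩ := Set.not_subset.1 fun h₃ => hi ⟨h₁, h₂, h₃⟩
      by_cases hq : γ ∈ q.s i
      · exact key γ hq fun h => lt_irrefl _ (p.s_lt_T i γ h γ hγ)
      · obtain ⟨r, hr, hrs, -⟩ := p.exists_add hγ
        refine ⟨r, hr, fun ⟨t, htr, htq⟩ => hγq ((htq i).2.1 γ ((htr i).1 ?_) hq)⟩
        rw [hrs]
        exact mem_addPoint.2 (Or.inr ⟨rfl, rfl⟩)
    · push Not at h₂
      obtain ⟨β, hβ, hβq, hβT⟩ := h₂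
      exact ⟨p, le_rfl, fun ⟨t, htp, htq⟩ => hβT ((htq i).2.1 β ((htp i).1 hβ) hβq)⟩
  · obtain ⟨β, hβ, hβp⟩ := Finset.not_subset.1 h₁
    exact key β hβ hβp

/-! ### Stems that force a Boolean value. -/

/-- Some condition with the stem `s` forces `b`. -/
def StemForces (b : Completion S.Condition) (s : Set.Iio α → Finset Ordinal.{u}) : Prop :=
  ∃ q : S.Condition, q.s = s ∧ emb q ≤ b

variable {S}

/-- Subsets of the smaller blocks may be taken to be constant on a measure one set. -/
theorem setOf_forall_mem_iff_mem (i : Set.Iio α)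
    (T : Ordinal.{u} → Set.Iio α → Set Ordinal.{u}) (hT : ∀ ξ j, T ξ j ⊆ S.block j) :
    {ξ | ∀ j < i, ∀ β, β ∈ T ξ j ↔ {ζ | β ∈ T ζ j} ∈ S.U i} ∈ S.U i := by
  obtain ⟨δ, hδ, hj⟩ := S.discrete i
  -- Each `β` lies in at most one block, so only one index `j` matters. All blocks below `i` lie
  -- under `δ < κ i`, so completeness combines the sets for all `β`.
  have hX : ∀ β < δ, {ξ | ∀ j < i, (β ∈ T ξ j ↔ {ζ | β ∈ T ζ j} ∈ S.U i)} ∈ S.U i := by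
    intro β _
    have hout : ∀ j, β ∉ S.block j → ∀ ξ, β ∈ T ξ j ↔ {ζ | β ∈ T ζ j} ∈ S.U i := by
      intro j hβ ξ
      refine iff_of_false (fun h => hβ (hT ξ j h)) fun h => ?_
      obtain ⟨ζ, hζ⟩ := Filter.nonempty_of_mem h
      exact hβ (hT ζ j hζ)
    by_cases h : ∃ j, β ∈ S.block j
    · obtain ⟨j, hβ⟩ := h
      have hj' : {ξ | β ∈ T ξ j ↔ {ζ | β ∈ T ζ j} ∈ S.U i} ∈ S.U i := by
        by_cases hm : {ζ | β ∈ T ζ j} ∈ S.U i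
        · filter_upwards [hm] with ξ hξ using iff_of_true hξ hm
        · filter_upwards [Ultrafilter.compl_mem_iff_notMem.2 hm] with ξ hξ
          exact iff_of_false hξ hm
      filter_upwards [hj'] with ξ hξ k _
      by_cases hk : β ∈ S.block k
      · rwa [S.block_unique hk hβ]
      · exact hout k hk ξ
    · exact Filter.mem_of_superset Filter.univ_mem fun ξ _ j _ => hout j (fun hβ => h ⟨j, hβ⟩) ξ
  filter_upwards [(S.normal i).forall_lt_mem hδ hX] with ξ hξ j hji β
  by_cases hβ : β ∈ S.block j
  · exact hξ β (hβ.1.trans_le (hj j hji)) j hji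
  · refine iff_of_false (fun h => hβ (hT ξ j h)) fun h => ?_
    obtain ⟨ζ, hζ⟩ := Filter.nonempty_of_mem h
    exact hβ (hT ζ j hζ)

/-- Witnesses `q ξ` for the stems with `ξ` added are merged into one condition `q₀` with the stem of
`p`. Every extension of `q₀` with a new point at `i` is compatible with `q ξ`, where `ξ` is its
least new point there; as there is room at `i`, such extensions are dense below `q₀`. -/
theorem stemForces_of_addPoint {b : Completion S.Condition} (p : S.Condition) (i : Set.Iio α)
    (hi : ((p.s i).card : ℕ∞) < S.η i)
    (hX : {ξ | S.StemForces b (addPoint p.s i ξ)} ∈ S.U i) : S.StemForces b p.s := by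
  classical
  -- Outside `X` the value of `q` is irrelevant, and `p` serves as a default.
  have hq' : ∀ ξ, ∃ q : S.Condition, S.StemForces b (addPoint p.s i ξ) →
      q.s = addPoint p.s i ξ ∧ emb q ≤ b := by
    intro ξ
    by_cases h : S.StemForces b (addPoint p.s i ξ)
    · obtain ⟨q, hq⟩ := h
      exact ⟨q, fun _ => hq⟩
    · exact ⟨p, fun h' => absurd h' h⟩
  choose q hq using hq'
  set X := {ξ | S.StemForces b (addPoint p.s i ξ)}
  set E := {ξ | ∀ j < i, ∀ β, β ∈ (q ξ).T j ↔ {ζ | β ∈ (q ζ).T j} ∈ S.U i}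
  have hE : E ∈ S.U i := setOf_forall_mem_iff_mem i (fun ξ => (q ξ).T) fun ξ => (q ξ).T_subset
  have hcard : ∀ ξ ∈ X, ∀ j ≠ i, ((q ξ).s j).card = (p.s j).card := by
    intro ξ hξ j hj
    rw [(hq ξ hξ).1]
    simp [addPoint, hj]
  -- Below `i`: the stable value of the sets `(q ξ).T j`. At `i`: their diagonal intersection, only
  -- over those `q ξ` with room left, since otherwise `(q ξ).T i` is empty. Above `i`: the full
  -- intersection, over at most `κ i < κ j` many `ξ`.
  let R : Set.Iio α → Set Ordinal.{u} := fun j =>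
    {β | (j < i → {ζ | β ∈ (q ζ).T j} ∈ S.U i) ∧
      (j = i → β ∈ X ∩ E ∧
        ∀ ξ < β, ξ ∈ X → (((q ξ).s i).card : ℕ∞) < S.η i → β ∈ (q ξ).T i) ∧
      (i < j → ∀ ξ < (S.κ i).ord, ξ ∈ X → β ∈ (q ξ).T j)}
  have hR : ∀ j, ((p.s j).card : ℕ∞) < S.η j → R j ∈ S.U j := by
    intro j hj
    rcases lt_trichotomy j i with h | rfl | h
    · obtain ⟨ξ, hξ, hξE⟩ := Filter.nonempty_of_mem (Filter.inter_mem hX hE)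
      filter_upwards [(q ξ).T_mem j (by rwa [hcard ξ hξ j h.ne])] with β hβ
      exact ⟨fun _ => (hξE j h β).1 hβ, fun h' => absurd h' h.ne, fun h' => absurd h' h.not_gt⟩
    · have hd := (S.normal j).normal
        (fun ξ => {β | ξ ∈ X → (((q ξ).s j).card : ℕ∞) < S.η j → β ∈ (q ξ).T j}) fun ξ _ => by
          by_cases hξ : (((q ξ).s j).card : ℕ∞) < S.η j
          · exact Filter.mem_of_superset ((q ξ).T_mem j hξ) fun β hβ _ _ => hβ
          · exact Filter.mem_of_superset Filter.univ_mem fun β _ _ h' => absurd h' hξ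
      filter_upwards [hX, hE, hd] with β h₁ h₂ h₃
      exact ⟨fun h' => absurd h' (lt_irrefl _), fun _ => ⟨⟨h₁, h₂⟩, h₃⟩,
        fun h' => absurd h' (lt_irrefl _)⟩
    · have hm := (S.normal j).forall_lt_mem (Cardinal.ord_lt_ord.2 (S.strictMono h))
        (X := fun ξ => {β | ξ ∈ X → β ∈ (q ξ).T j}) fun ξ _ => by
          by_cases hξ : ξ ∈ X
          · exact Filter.mem_of_superset ((q ξ).T_mem j (by rwa [hcard ξ hξ j h.ne']))
              fun β hβ _ => hβ
          · exact Filter.mem_of_superset Filter.univ_mem fun β _ h' => absurd h' hξ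
      filter_upwards [hm] with β hβ
      exact ⟨fun h' => absurd h' h.not_gt, fun h' => absurd h' h.ne', fun _ => hβ⟩
  obtain ⟨q₀, hs, -, hT⟩ := p.exists_shrink R hR
  refine ⟨q₀, hs, emb_le_of_dense fun r hr => ?_⟩
  /- It suffices to consider extensions which add some point at `i`. -/
  suffices H : ∀ r ≤ q₀, r.s i ≠ p.s i → ∃ t ≤ r, emb t ≤ b by
    by_cases hri : r.s i = p.s i
    · obtain ⟨γ, hγ⟩ := Filter.nonempty_of_mem (r.T_mem i (hri ▸ hi))
      obtain ⟨r', hr', hrs, -⟩ := r.exists_add hγ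
      obtain ⟨t, ht, htb⟩ := H r' (hr'.trans hr) fun h => by
        have : γ ∈ r.s i := by
          rw [hri, ← h, hrs]
          exact mem_addPoint.2 (Or.inr ⟨rfl, rfl⟩)
        exact lt_irrefl _ (r.s_lt_T i γ this γ hγ)
      exact ⟨t, ht.trans hr', htb⟩
    · exact H r hr hri
  intro r hr hri
  have hsub : ∀ j, p.s j ⊆ r.s j := fun j => hs ▸ (hr j).1
  have hnew : ∀ j, ∀ β ∈ r.s j, β ∉ p.s j → β ∈ R j := fun j β hβ hβ' => by
    have := (hr j).2.1 β hβ (hs ▸ hβ')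
    rw [hT] at this
    exact this.2
  have hne : (r.s i \ p.s i).Nonempty :=
    Finset.sdiff_nonempty.2 fun h => hri (h.antisymm (hsub i))
  obtain ⟨hξr, hξp⟩ := Finset.mem_sdiff.1 (Finset.min'_mem _ hne)
  -- By minimality every other new point at `i` is above `ξ`, so the diagonal intersection puts it
  -- into `(q ξ).T i`.
  set ξ := (r.s i \ p.s i).min' hne
  have hξX := ((hnew i ξ hξr hξp).2.1 rfl).1
  obtain ⟨hqs, hqb⟩ := hq ξ hξX.1
  have hqr : ∀ j, (q ξ).s j ⊆ r.s j := fun j β hβ => by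
    rw [hqs] at hβ
    rcases mem_addPoint.1 hβ with h | ⟨rfl, rfl⟩
    · exact hsub j h
    · exact hξr
  obtain ⟨t, -, htr, htq⟩ := exists_le_of_stem r (q ξ) hqr
    (fun j β hβ hβ' => by
      have hβq := hβ'
      rw [hqs, mem_addPoint, not_or] at hβ'
      have hβR := hnew j β hβ hβ'.1
      rcases lt_trichotomy j i with h | rfl | h
      · exact (hξX.2 j h β).2 (hβR.1 h)
      · refine (hβR.2.1 rfl).2 ξ (lt_of_le_of_ne ?_ fun h => hβ'.2 ⟨rfl, h.symm⟩) hξX.1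
          (lt_of_lt_of_le ?_ (r.card_le j))
        · exact Finset.min'_le _ _ (Finset.mem_sdiff.2 ⟨hβ, hβ'.1⟩)
        -- The point `β` is missing from the stem of `q ξ`, so that stem is not yet full at `i`.
        · exact_mod_cast Finset.card_lt_card
            ((Finset.ssubset_iff_of_subset (hqr j)).2 ⟨β, hβ, hβq⟩)
      · exact hβR.2.2 h ξ (r.s_subset i hξr).1 hξX.1)
  exact ⟨t, htr, (emb_mono htq).trans hqb⟩

/-- If no condition with the stem of `p` forces `b`, then `p` has a direct extension such that no
condition with the stem of an extension of it forces `b`. -/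
theorem exists_forall_not_stemForces {b : Completion S.Condition} (p : S.Condition)
    (hp : ¬ S.StemForces b p.s) :
    ∃ r, S.DirectExt r p ∧ ∀ t ≤ r, ¬ S.StemForces b t.s := by
  classical
  -- As the blocks are disjoint, a single finite set of ordinals codes the points added at all
  -- indices.
  let s : Finset Ordinal.{u} → Set.Iio α → Finset Ordinal.{u} := fun u i =>
    p.s i ∪ u.filter (· ∈ S.block i)
  -- If the points whose addition yields a forcing stem form a null set, they are removed; otherwise
  -- nothing is.
  let Y : Set.Iio α → Finset Ordinal.{u} → Set Ordinal.{u} := fun i u =>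
    {ξ | {ξ | S.StemForces b (addPoint (s u) i ξ)} ∉ S.U i → ¬ S.StemForces b (addPoint (s u) i ξ)}
  have hY : ∀ i u, Y i u ∈ S.U i := by
    intro i u
    by_cases h : {ξ | S.StemForces b (addPoint (s u) i ξ)} ∈ S.U i
    · exact Filter.mem_of_superset Filter.univ_mem fun ξ _ h' => absurd h h'
    · filter_upwards [Ultrafilter.compl_mem_iff_notMem.2 h] with ξ hξ _ using hξ
  obtain ⟨r, hrs, hrp, hrT⟩ := p.exists_shrink _ fun i _ =>
    (S.normal i).diagonal_finset_mem (hY i)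
  refine ⟨r, ⟨hrp, hrs⟩, fun t ht => ?_⟩
  -- Adding the largest point last, whatever its block, makes all earlier points smaller than it, as
  -- the diagonal intersection requires.
  have key : ∀ u : Finset Ordinal.{u}, (∀ β ∈ u, ∃ i, β ∈ t.s i ∧ β ∉ p.s i) →
      ¬ S.StemForces b (s u) := by
    intro u
    induction u using Finset.induction_on_max with
    | empty =>
      have h0 : s ∅ = p.s := by
        ext i β
        simp [s]
      exact fun _ => h0 ▸ hp
    | insert γ v hv ih =>
      intro hu
      specialize ih fun β hβ => hu β (Finset.mem_insert_of_mem hβ)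
      obtain ⟨i, hγt, hγp⟩ := hu γ (Finset.mem_insert_self γ v)
      have hγb := t.s_subset i hγt
      have hsub : ∀ j, s v j ⊆ t.s j := by
        intro j β hβ
        rcases Finset.mem_union.1 hβ with h | h
        · exact (ht j).1 (hrs ▸ h)
        · obtain ⟨hβv, hβj⟩ := Finset.mem_filter.1 h
          obtain ⟨k, hk, -⟩ := hu β (Finset.mem_insert_of_mem hβv)
          rwa [S.block_unique hβj (t.s_subset k hk)]
      have hγs : γ ∉ s v i := by
        intro h
        rcases Finset.mem_union.1 h with h | h
        · exact hγp h
        · exact lt_irrefl _ (hv γ (Finset.mem_filter.1 h).1)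
      have hcard : ((s v i).card : ℕ∞) < S.η i := by
        refine lt_of_lt_of_le ?_ (t.card_le i)
        exact_mod_cast Finset.card_lt_card
          (Finset.ssubset_iff_of_subset (hsub i) |>.2 ⟨γ, hγt, hγs⟩)
      obtain ⟨q, hq⟩ := t.exists_stem_eq (s v) hsub
      have hγT := (ht i).2.1 γ hγt (hrs ▸ hγp)
      rw [hrT] at hγT
      -- Measure one many forcing one-point extensions would make `s v` itself force `b`, against
      -- the induction hypothesis.
      have hmain := hγT.2 v hv fun hmem => ih (hq ▸ stemForces_of_addPoint q i (hq ▸ hcard)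
        (hq ▸ hmem))
      have heq : s (insert γ v) = addPoint (s v) i γ := by
        ext j β
        rw [mem_addPoint]
        simp only [s, Finset.mem_union, Finset.mem_filter, Finset.mem_insert]
        constructor
        · rintro (h | ⟨rfl | h, hj⟩)
          · exact Or.inl (Or.inl h)
          · exact Or.inr ⟨S.block_unique hj hγb, rfl⟩
          · exact Or.inl (Or.inr ⟨h, hj⟩)
        · rintro ((h | h) | ⟨rfl, rfl⟩)
          · exact Or.inl h
          · exact Or.inr ⟨Or.inr h.1, h.2⟩
          · exact Or.inr ⟨Or.inl rfl, hγb⟩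
      rwa [heq]
  have ht' := key (t.finite_dom.toFinset.biUnion fun i => t.s i \ p.s i) fun β hβ => by
    obtain ⟨i, -, h⟩ := Finset.mem_biUnion.1 hβ
    exact ⟨i, Finset.mem_sdiff.1 h⟩
  convert ht' using 2
  ext i β
  simp only [s, Finset.mem_union, Finset.mem_filter, Finset.mem_biUnion, Finset.mem_sdiff,
    Set.Finite.mem_toFinset, Set.mem_ofPred_eq]
  constructor
  · intro h
    by_cases hβ : β ∈ p.s i
    · exact Or.inl hβ
    · exact Or.inr ⟨⟨i, Finset.ne_empty_of_mem h, h, hβ⟩, t.s_subset i h⟩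
  · rintro (h | ⟨⟨j, -, h, -⟩, hi⟩)
    · exact (ht i).1 (hrs ▸ h)
    · rwa [S.block_unique hi (t.s_subset j h)]

/-! ### The Prikry property and the capture of maximal antichains. -/

theorem directExt_of_stemForces {b : Completion S.Condition} {p : S.Condition}
    (h : S.StemForces b p.s) : ∃ q, S.DirectExt q p ∧ emb q ≤ b := by
  obtain ⟨q, hq, hb⟩ := h
  obtain ⟨r, hr, hrp, hrq⟩ := exists_le_of_stem_eq hq.symm
  exact ⟨r, ⟨hrp, hr⟩, (emb_mono hrq).trans hb⟩

theorem exists_directExt_le_or_le_compl (b : Completion S.Condition) (p : S.Condition) :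
    ∃ q, S.DirectExt q p ∧ (emb q ≤ b ∨ emb q ≤ bᶜ) := by
  by_cases h : S.StemForces b p.s
  · obtain ⟨q, hq, hb⟩ := directExt_of_stemForces h
    exact ⟨q, hq, Or.inl hb⟩
  · obtain ⟨r, hr, hrt⟩ := exists_forall_not_stemForces p h
    exact ⟨r, hr, Or.inr (emb_le_compl fun t ht hb => hrt t ht ⟨t, rfl, hb⟩)⟩

/-- If no condition with the stem of `p` forces `b`, then some direct extension of `p` is
incompatible with all conditions whose stem is the stem of a condition forcing `b`. -/
theorem exists_forall_not_compat {b : Completion S.Condition}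
    (h : ¬ S.StemForces b (⊤ : S.Condition).s) :
    ∃ r, S.DirectExt r ⊤ ∧ ∀ a : S.Condition, S.StemForces b a.s → ¬ Compat r a := by
  obtain ⟨r, hr, hrt⟩ := exists_forall_not_stemForces ⊤ h
  refine ⟨r, hr, fun a ha ⟨t, htr, hta⟩ => ?_⟩
  -- The points of `a.s` lie in the stem of `t ≤ r`, hence in the measure one sets of `r`; so `a.s`
  -- is itself the stem of an extension of `r`.
  obtain ⟨q, hq⟩ := t.exists_stem_eq a.s fun i => (hta i).1
  have hrs : ∀ i, r.s i = ∅ := fun i => congrFun hr.2 i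
  obtain ⟨q', hq's, -, hq'⟩ := exists_le_of_stem q r (fun i => by simp [hrs]) fun i β hβ _ =>
    (htr i).2.1 β ((hta i).1 (hq ▸ hβ)) (by simp [hrs])
  exact hrt q' hq' (by rwa [hq's, hq])

theorem prikryProperty : PrikryProperty S.DirectExt where
  refl _ := ⟨le_rfl, rfl⟩
  le_of_le₁ _ _ h := h.1
  decides φ p := exists_directExt_le_or_le_compl (φ.val Fin.elim0) p

theorem captured {A : Set S.Condition} (hA : IsMaximalAntichain A) (f : A → Completion S.Condition)
    (hf : ∀ a : A, f a ≤ emb (a : S.Condition)) :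
    BoolLe₁ S.DirectExt (⨆ a : A, f a) ⊤ ↔
      BoolLe₁ S.DirectExt
        (⨆ a : {a : A // BoolLe₁ S.DirectExt (f a) (a : S.Condition)},
          emb (a.1 : S.Condition)) ⊤ := by
  have htop : ∀ c : Completion S.Condition, c ≤ emb ⊤ := fun c =>
    le_top.trans (compl_eq_bot.1 (by
      by_contra hne
      obtain ⟨r, -, hr⟩ := exists_emb_le _ hne
      exact not_emb_le_compl (emb_mono le_top) hr)).ge
  constructor
  · rintro ⟨-, q, hq, hqf⟩
    refine ⟨htop _, ?_⟩
    have hn : ¬ S.StemForces (⨆ a : A, f a)ᶜ (⊤ : S.Condition).s := by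
      rintro ⟨r, hrs, hr⟩
      obtain ⟨t, -, htq, htr⟩ := exists_le_of_stem_eq (hq.2.trans hrs.symm)
      exact not_emb_le_compl ((emb_mono htq).trans hqf) ((emb_mono htr).trans hr)
    obtain ⟨r, hr, hrA⟩ := exists_forall_not_compat hn
    refine ⟨r, hr, emb_le_of_dense fun t ht => ?_⟩
    obtain ⟨a, ha, t', ht't, ht'a⟩ := hA.exists_compat t
    refine ⟨t', ht't, (emb_mono ht'a).trans ?_⟩
    suffices h : BoolLe₁ S.DirectExt (f ⟨a, ha⟩) a from
      le_iSup (fun a : {a : A // BoolLe₁ S.DirectExt (f a) (a : S.Condition)} =>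
        emb (a.1 : S.Condition)) ⟨⟨a, ha⟩, h⟩
    refine ⟨hf ⟨a, ha⟩, ?_⟩
    -- If `p` forced the complement of `f a`, it would force the complement of the whole supremum,
    -- since every other `f c` lies below some `c` incompatible with `a`. Then `r` would be
    -- incompatible with `a`.
    obtain ⟨p, hp, hpf | hpf⟩ := exists_directExt_le_or_le_compl (f ⟨a, ha⟩) a
    · exact ⟨p, hp, hpf⟩
    · refine absurd ⟨t', ht't.trans ht, ht'a⟩ (hrA a ⟨p, hp.2, ?_⟩)
      rw [compl_iSup]
      refine le_iInf fun ⟨c, hc⟩ => ?_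
      by_cases hac : a = c
      · subst hac
        exact hpf
      · refine emb_le_compl fun s hs hsf => hA.prop a ha c hc hac ?_
        obtain ⟨s', h₁, h₂⟩ := compat_of_emb_le (hsf.trans (hf ⟨c, hc⟩))
        exact ⟨s', h₁.trans (hs.trans hp.1), h₂⟩
  · rintro ⟨-, q, hq, hqf⟩
    refine ⟨htop _, ?_⟩
    by_contra hn
    have hn' : ¬ S.StemForces (⨆ a : A, f a) (⊤ : S.Condition).s := fun h =>
      hn (directExt_of_stemForces h)
    obtain ⟨r, hr, hrA⟩ := exists_forall_not_compat hn'
    obtain ⟨t, -, htq, htr⟩ := exists_le_of_stem_eq (hq.2.trans hr.2.symm)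
    obtain ⟨a, t', ht't, ht'a⟩ :=
      exists_emb_le_of_le_iSup ((emb_mono htq).trans hqf)
    obtain ⟨t'', h₁, h₂⟩ := compat_of_emb_le ht'a
    obtain ⟨p, hp, hpf⟩ := a.2.2
    -- The witness `p` for `f a ≤₁ a` shows that the stem of `a` forces the supremum, yet `a` is
    -- compatible with `r`.
    exact hrA a.1 ⟨p, hp.2, hpf.trans (le_iSup f a.1)⟩ ⟨t'', h₁.trans (ht't.trans htr), h₂⟩

end PrikryParams

end StrongPrikry

theorem mainTheorem5 {α : Ordinal.{u}} (S : StrongPrikry.PrikryParams α) :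
    StrongPrikry.StrongPrikryProperty S.DirectExt := by
  exact
    { StrongPrikry.PrikryParams.prikryProperty with
      separative := S.separative_condition
      directed := fun p q r hq hr => by
        obtain ⟨s, hs, hsq, hsr⟩ :=
          StrongPrikry.PrikryParams.Condition.exists_le_of_stem_eq (hq.2.trans hr.2.symm)
        exact ⟨s, ⟨hsq.trans hq.1, hs.trans hq.2⟩, hsq, hsr⟩
      connected := fun p q q' hq hqq' hq' => ⟨hq', funext fun i =>
        ((hqq' i).1.trans (congrFun hq.2 i).subset).antisymm (hq' i).1⟩
      captured := fun A hA f hf => StrongPrikry.PrikryParams.captured hA f hf }
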